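/- All rings are commutative with identity and nonzero. Elements $a,b$ of a ring are associates, $a\sim b$, if $a\mid b$ and $b\mid a$; they are strong associates if $a=ub$ for a unit $u$, and very strong associates if $a\sim b$ and either $a=b=0$, or $a\neq 0$ and $a=rb$ implies that $r$ is a unit. A nonunit $a$ is irreducible (resp. strongly irreducible, very strongly irreducible) if $a=bc$ implies that $a$ is an associate (resp. a strong associate, a very strong associate) of $b$ or of $c$; it is $m$-irreducible if $Ra$ is maximal among the proper principal ideals. A ring is a finite factorization ring (FFR) if every nonzero nonunit has only finitely many factorizations into nonunits up to order and associates; an FFD is an integral domain that is an FFR. A ring is a unique factorization ring (UFR) if, for some one of the four kinds of irreducible elements and some one of the three kinds of associates, every nonzero nonunit is a finite product of irreducible elements of that kind, and any two such factorizations of a nonzero nonunit have the same length and, after reordering, factors that are associates of that kind. **Theorem 6.3.** Let $R$ be a ring and $X$ an indeterminate over $R$. Then $R[X]$ is an FFR if and only if either (1) $R$ is an FFD, or (2) $R$ is a finite local ring with maximal ideal $M$ which, with $n\ge 1$ given by $M^n=0\neq M^{n-1}$, satisfies (a) if $1\le k\le n-1$ and $x_1,\dots,x_k\in M\setminus M^2$,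 then $x_1\cdots x_k\in M^k\setminus M^{k+1}$, and (b) $aM=M^2$ for every $a\in M\setminus M^2$. Moreover, for a finite local ring $(R,M)$ with $M^n=0\ne M^{n-1}$ that satisfies (b), condition (a) is equivalent to: for all $i,j\ge 0$ with $i+j<n$, if $x\in M^i\setminus M^{i+1}$ and $y\in M^j\setminus M^{j+1}$, then $xy\in M^{i+j}\setminus M^{i+j+1}$. Consequently, if $R$ is a UFR, then $R[X]$ is an FFR if and only if $R$ is a UFD or $R$ is finite. -/

import Mathlib

open Polynomial

namespace FactorRing

section Defs

variable {R : Type*} [CommRing R]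

/-- `a` and `b` are associates: each divides the other, i.e. `Ra = Rb`.
(Mathlib's `Associated` is the stronger relation `a = ub` with `u` a unit.) -/
def Assoc (a b : R) : Prop := a ∣ b ∧ b ∣ a

/-- `a` and `b` are strong associates: `a = ub` for some unit `u`. -/
def StrongAssoc (a b : R) : Prop := ∃ u : R, IsUnit u ∧ a = u * b

/-- `a` and `b` are very strong associates: they are associates and either `a = b = 0`, or `a ≠ 0`
and `a = rb` forces `r` to be a unit. -/
def VeryStrongAssoc (a b : R) : Prop :=
  Assoc a b ∧ ((a = 0 ∧ b = 0) ∨ (a ≠ 0 ∧ ∀ r : R, a = r * b → IsUnit r))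

/-- `s` is (up to order) a factorization `a = a₁ ⋯ aₙ` of `a` into nonunits. -/
def IsFactorization (s : Multiset R) (a : R) : Prop :=
  (∀ x ∈ s, ¬ IsUnit x) ∧ s.prod = a

variable (R) in
/-- Finite factorization ring: every nonzero nonunit has, up to order and associates, only
finitely many factorizations into nonunits. `Multiset.Rel Assoc s t` says that the factors of `s`
and `t` can be matched bijectively with associates. -/
def IsFFR : Prop :=
  ∀ a : R, a ≠ 0 → ¬ IsUnit a →
    ∃ F : Set (Multiset R), F.Finite ∧
      ∀ s : Multiset R, IsFactorization s a → ∃ t ∈ F, IsFactorization t a ∧ Multiset.Rel Assoc s t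

variable (R) in
/-- Finite factorization domain. -/
def IsFFD : Prop := IsDomain R ∧ IsFFR R

/-- The four kinds of irreducible elements. -/
inductive IrredKind
  | irred
  | strong
  | maximal
  | veryStrong

/-- The three kinds of associate relations. -/
inductive AssocKind
  | assoc
  | strong
  | veryStrong

/-- The associate relation of the given kind. -/
def AssocRel : AssocKind → R → R → Prop
  | .assoc => Assoc
  | .strong => StrongAssoc
  | .veryStrong => VeryStrongAssoc

/-- A nonunit `a` is irreducible with respect to the relation `r` if `a = bc` implies that `a` is
related to `b` or to `c`. -/
def IrredWith (r : R → R → Prop) (a : R) : Prop :=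
  ¬ IsUnit a ∧ ∀ b c : R, a = b * c → r a b ∨ r a c

/-- A nonunit `a` is m-irreducible if `Ra` is maximal among the proper principal ideals. -/
def MIrred (a : R) : Prop :=
  ¬ IsUnit a ∧
    Maximal (fun I : Ideal R => I ≠ ⊤ ∧ ∃ b : R, I = Ideal.span {b}) (Ideal.span {a})

/-- Irreducibility of the given kind. -/
def IsIrred : IrredKind → R → Prop
  | .irred => IrredWith Assoc
  | .strong => IrredWith StrongAssoc
  | .maximal => MIrred
  | .veryStrong => IrredWith VeryStrongAssoc

variable (R) in
/-- `(α, β)`-unique factorization ring: every nonzero nonunit is a finite product of irreducibles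
of kind `α`, and any two such factorizations agree up to order and associates of kind `β`. -/
def IsUFROfKind (α : IrredKind) (β : AssocKind) : Prop :=
  (∀ a : R, a ≠ 0 → ¬ IsUnit a →
    ∃ s : Multiset R, (∀ x ∈ s, IsIrred α x) ∧ s.prod = a) ∧
  (∀ a : R, a ≠ 0 → ¬ IsUnit a → ∀ s t : Multiset R,
    (∀ x ∈ s, IsIrred α x) → s.prod = a → (∀ x ∈ t, IsIrred α x) → t.prod = a →
      Multiset.Rel (AssocRel β) s t)

variable (R) in
/-- Unique factorization ring: an `(α, β)`-unique factorization ring for some `(α, β)`. -/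
def IsUFR : Prop := ∃ α β, IsUFROfKind R α β

/-- Products of `k` elements of `M \ M²` lie in `M ^ k \ M ^ (k + 1)`, for `1 ≤ k ≤ n - 1`. -/
def CondA (M : Ideal R) (n : ℕ) : Prop :=
  ∀ k : ℕ, 1 ≤ k → k < n → ∀ x : Fin k → R, (∀ i, x i ∈ M ∧ x i ∉ M ^ 2) →
    ∏ i, x i ∈ M ^ k ∧ ∏ i, x i ∉ M ^ (k + 1)

/-- The variant of the previous condition on products of two elements. -/
def CondA' (M : Ideal R) (n : ℕ) : Prop :=
  ∀ i j : ℕ, i + j < n → ∀ x y : R, x ∈ M ^ i → x ∉ M ^ (i + 1) → y ∈ M ^ j → y ∉ M ^ (j + 1) →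
    x * y ∈ M ^ (i + j) ∧ x * y ∉ M ^ (i + j + 1)

/-- `aM = M²` for every `a ∈ M \ M²`. -/
def CondB (M : Ideal R) : Prop :=
  ∀ a : R, a ∈ M → a ∉ M ^ 2 → Ideal.span {a} * M = M ^ 2

/-- `n` is the index of nilpotency of `M`: `M ^ n = 0` but `M ^ (n - 1) ≠ 0`. -/
def IsNilpIndex (M : Ideal R) (n : ℕ) : Prop :=
  1 ≤ n ∧ M ^ n = ⊥ ∧ M ^ (n - 1) ≠ ⊥

end Defs

end FactorRing

namespace FactorRing

/-! ### Associates, présimplifiable rings and finiteness criteria. -/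

section Basic

variable {A : Type*} [CommRing A]

/-! An FFR is présimplifiable, so there associates differ by units and infinitely many pairwise
nonassociate nonunits sharing one cofactor of a nonzero element give a contradiction.

Necessity: if `zw = 0` with `z, w ≠ 0`, the factors `X + p` of `zX` with `zp = 0` show that
annihilators are finite, hence so is `R` (`finite_of_mul_eq_zero`). A finite présimplifiable ring is
local, since its elements are units or nilpotent. The factors `y + xX^(k+1)` of `cy`, where `cx = 0
≠ cy`, force `x ∈ yM` (`exists_eq_mul_of_isFFR`); this exchange principle yields both (a) and (b).

Sufficiency: over a domain, a divisor is determined up to associates by its class over the fraction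
field and the class of its leading coefficient. Over a finite local ring, (a) makes the order `(i,
d)` of a polynomial additive on nonzero products (`HasOrder.mul`), which bounds the lengths of
factorizations, and (b) permits enough division to make each polynomial an associate of one of
degree at most `d`; there are finitely many of these.

A UFR is présimplifiable too, so all kinds of irreducibles and of associates agree on nonzero
elements. If it is finite, it is local with `M² = 0` or `M` principal, and (a) and (b) follow in
either case. -/

theorem Assoc.symm {a b : A} (h : Assoc a b) : Assoc b a := ⟨h.2, h.1⟩

theorem Assoc.trans {a b c : A} (h : Assoc a b) (h' : Assoc b c) : Assoc a c :=
  ⟨h.1.trans h'.1, h'.2.trans h.2⟩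

theorem _root_.Associated.assoc {a b : A} (h : Associated a b) : Assoc a b :=
  ⟨h.dvd, h.symm.dvd⟩

theorem rel_assoc_symm {s t : Multiset A} (h : Multiset.Rel Assoc s t) :
    Multiset.Rel Assoc t s :=
  Multiset.rel_flip.1 (h.mono fun _ _ _ _ hab => hab.symm)

theorem rel_assoc_trans {s t u : Multiset A} (h : Multiset.Rel Assoc s t)
    (h' : Multiset.Rel Assoc t u) : Multiset.Rel Assoc s u :=
  haveI : IsTrans A Assoc := ⟨fun _ _ _ => Assoc.trans⟩
  h.trans Assoc h'

/-- Présimplifiable rings: `a = ab` with `a ≠ 0` forces `b` to be a unit. -/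
def IsPresimplifiable (A : Type*) [CommRing A] : Prop :=
  ∀ a b : A, a ≠ 0 → a = a * b → IsUnit b

theorem IsPresimplifiable.associated (h : IsPresimplifiable A) {a b : A} (hab : Assoc a b) :
    Associated a b := by
  obtain ⟨⟨c, rfl⟩, ⟨d, hd⟩⟩ := hab
  by_cases ha : a = 0
  · simp [ha]
  · have : IsUnit (c * d) := h a _ ha (by rw [← mul_assoc]; exact hd)
    exact ⟨(isUnit_of_mul_isUnit_left this).unit, rfl⟩

/-- Each such multiset lies below `N` copies of `D`. -/
theorem finite_multiset_of_mem_of_card_le {α : Type*} {D : Set α} (hD : D.Finite) (N : ℕ) :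
    {s : Multiset α | (∀ x ∈ s, x ∈ D) ∧ s.card ≤ N}.Finite := by
  classical
  refine (Set.finite_Iic (N • hD.toFinset.val)).subset ?_
  rintro s ⟨hs, hN⟩
  rw [Set.mem_Iic, Multiset.le_iff_count]
  intro x
  by_cases hx : x ∈ s
  · have h1 : 1 ≤ Multiset.count x hD.toFinset.val :=
      Multiset.one_le_count_iff_mem.2 (by simpa using hs x hx)
    rw [Multiset.count_nsmul]
    calc _ ≤ s.card := Multiset.count_le_card _ _
      _ ≤ N := hN
      _ ≤ N * _ := Nat.le_mul_of_pos_right _ h1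
  · simp [Multiset.count_eq_zero_of_notMem hx]

/-- Finitely many possible factors and bounded lengths give finitely many factorizations. -/
theorem exists_finite_of_factors {a : A} {D : Set A} (hD : D.Finite) (N : ℕ)
    (h : ∀ s, IsFactorization s a → s.card ≤ N ∧ ∀ x ∈ s, ∃ d ∈ D, Assoc x d) :
    ∃ F : Set (Multiset A), F.Finite ∧
      ∀ s : Multiset A, IsFactorization s a → ∃ t ∈ F, IsFactorization t a ∧
        Multiset.Rel Assoc s t := by
  classical
  let T : Set (Multiset A) := {t | (∀ x ∈ t, x ∈ D) ∧ t.card ≤ N}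
  have hT : T.Finite := finite_multiset_of_mem_of_card_le hD N
  -- A multiset over `D` need not have product `a`, so it is replaced by an actual factorization
  -- matching it; the default `0` is never used.
  let g : Multiset A → Multiset A := fun t =>
    if ht : ∃ s, IsFactorization s a ∧ Multiset.Rel Assoc s t then ht.choose else 0
  refine ⟨g '' T, hT.image g, fun s hs => ?_⟩
  obtain ⟨hN, hsD⟩ := h s hs
  choose! f hf using hsD
  have hrel : Multiset.Rel Assoc s (s.map f) :=
    Multiset.rel_map_right.2 (Multiset.rel_refl_of_refl_on fun x hx => (hf x hx).2)
  have hex : ∃ s', IsFactorization s' a ∧ Multiset.Rel Assoc s' (s.map f) := ⟨s, hs, hrel⟩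
  have hg : g (s.map f) = hex.choose := dif_pos hex
  refine ⟨g (s.map f), ⟨s.map f, ⟨?_, by simpa using hN⟩, rfl⟩, ?_, ?_⟩
  · intro x hx
    obtain ⟨y, hy, rfl⟩ := Multiset.mem_map.1 hx
    exact (hf y hy).1
  · rw [hg]; exact hex.choose_spec.1
  · rw [hg]; exact rel_assoc_trans hrel (rel_assoc_symm hex.choose_spec.2)

theorem IsFFR.exists_finite_divisors (h : IsFFR A) {a : A} (ha : a ≠ 0) :
    ∃ D : Set A, D.Finite ∧
      ∀ x c : A, ¬ IsUnit x → ¬ IsUnit c → x * c = a → ∃ d ∈ D, Assoc x d := by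
  by_cases hu : IsUnit a
  · exact ⟨∅, Set.finite_empty, fun x c hx _ hxc =>
      absurd (isUnit_of_mul_isUnit_left (hxc ▸ hu)) hx⟩
  obtain ⟨F, hF, hs⟩ := h a ha hu
  refine ⟨⋃ t ∈ F, {x | x ∈ t}, hF.biUnion fun t _ => t.finite_toSet, fun x c hx hc hxc => ?_⟩
  obtain ⟨t, ht, -, hrel⟩ := hs {x, c} ⟨by simp [hx, hc], by simpa using hxc⟩
  obtain ⟨d, hd, hxd⟩ := Multiset.exists_mem_of_rel_of_mem hrel (a := x) (by simp)
  exact ⟨d, Set.mem_biUnion ht hd, hxd⟩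

theorem IsFFR.exists_assoc (h : IsFFR A) {a c : A} (ha : a ≠ 0) (hc : ¬ IsUnit c)
    {ι : Type*} [Infinite ι] (g : ι → A) (hg : ∀ i, ¬ IsUnit (g i)) (hgc : ∀ i, c * g i = a) :
    ∃ i j, i ≠ j ∧ Assoc (g i) (g j) := by
  obtain ⟨D, hD, hDx⟩ := h.exists_finite_divisors ha
  choose f hf hgf using fun i => hDx (g i) c (hg i) hc (by rw [mul_comm, hgc])
  have := hD.to_subtype
  obtain ⟨i, j, hij, he⟩ := Finite.exists_ne_map_eq_of_infinite fun i => (⟨f i, hf i⟩ : D)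
  refine ⟨i, j, hij, (hgf i).trans ?_⟩
  rw [Subtype.mk.inj he]
  exact (hgf j).symm

/-- If `x = xy` with `y` a nonunit, then `x = xy^k` for all `k`: factorizations of unboundedly many
lengths, while matching preserves length. -/
theorem IsFFR.isPresimplifiable (h : IsFFR A) : IsPresimplifiable A := by
  intro x y hx hxy
  by_contra hy
  have hux : ¬ IsUnit x := fun hu => hy (by
    have : y = 1 := hu.mul_left_cancel (by rw [mul_one]; exact hxy.symm)
    rw [this]; exact isUnit_one)
  obtain ⟨F, hF, hs⟩ := h x hx hux
  have hpow : ∀ k : ℕ, x * y ^ k = x := by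
    intro k
    induction k with
    | zero => simp
    | succ k ih => rw [pow_succ, ← mul_assoc, ih, ← hxy]
  choose t ht _ hrel using fun k : ℕ => hs (x ::ₘ Multiset.replicate k y)
    ⟨fun z hz => by
      rcases Multiset.mem_cons.1 hz with rfl | hz
      · exact hux
      · rw [Multiset.eq_of_mem_replicate hz]; exact hy, by simp [hpow]⟩
  have := hF.to_subtype
  obtain ⟨i, j, hij, he⟩ := Finite.exists_ne_map_eq_of_infinite fun i => (⟨t i, ht i⟩ : F)
  have h1 := Multiset.card_eq_card_of_rel (hrel i)
  have h2 := Multiset.card_eq_card_of_rel (hrel j)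
  rw [Subtype.mk.inj he, ← h2] at h1
  simp at h1
  exact hij h1

theorem IsFFR.finite_divisors (h : IsFFR A) {a : A} (ha : a ≠ 0) :
    {d : Associates A | d ∣ Associates.mk a}.Finite := by
  obtain ⟨D, hD, hDx⟩ := h.exists_finite_divisors ha
  refine ((hD.image Associates.mk).union (Set.toFinite {1, Associates.mk a})).subset ?_
  intro d
  obtain ⟨x, rfl⟩ := Associates.mk_surjective d
  intro hx
  obtain ⟨c, rfl⟩ := Associates.mk_dvd_mk.1 hx
  by_cases hu : IsUnit x
  · right; left; exact Associates.mk_eq_one.2 hu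
  by_cases hc : IsUnit c
  · right; right
    exact Associates.mk_eq_mk_iff_associated.2 ⟨hc.unit, rfl⟩
  · obtain ⟨d, hd, hxd⟩ := hDx x c hu hc rfl
    left
    exact ⟨d, hd, Associates.mk_eq_mk_iff_associated.2
      (h.isPresimplifiable.associated hxd.symm)⟩

theorem finite_divisors_of_ufm [UniqueFactorizationMonoid A] {a : A} (ha : a ≠ 0) :
    {d : Associates A | d ∣ Associates.mk a}.Finite := by
  classical
  let _ := UniqueFactorizationMonoid.strongNormalizationMonoid (α := A)
  refine ((Set.finite_Iic (UniqueFactorizationMonoid.normalizedFactors a)).image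
    fun s => Associates.mk s.prod).subset ?_
  intro d
  obtain ⟨x, rfl⟩ := Associates.mk_surjective d
  intro hx
  have hxa := Associates.mk_dvd_mk.1 hx
  have hx0 : x ≠ 0 := ne_zero_of_dvd_ne_zero ha hxa
  exact ⟨_, (UniqueFactorizationMonoid.dvd_iff_normalizedFactors_le_normalizedFactors
    hx0 ha).1 hxa, Associates.mk_eq_mk_iff_associated.2
      (UniqueFactorizationMonoid.prod_normalizedFactors hx0)⟩

end Basic

/-! ### Polynomials over a finite factorization domain. -/

section Domain

variable {A : Type*} [CommRing A] [IsDomain A]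

/-- Each further nonunit factor strictly enlarges the set of divisor classes. -/
theorem card_le_ncard_divisors
    (h : ∀ a : A, a ≠ 0 → {d : Associates A | d ∣ Associates.mk a}.Finite) (s : Multiset A) :
    (∀ x ∈ s, ¬ IsUnit x) → s.prod ≠ 0 →
      s.card ≤ {d : Associates A | d ∣ Associates.mk s.prod}.ncard := by
  induction s using Multiset.induction_on with
  | empty => simp
  | cons x s ih =>
    intro hs h0
    rw [Multiset.prod_cons] at h0 ⊢
    have hs0 : s.prod ≠ 0 := right_ne_zero_of_mul h0
    rw [Multiset.card_cons]
    refine (ih (fun y hy => hs y (Multiset.mem_cons_of_mem hy)) hs0).trans_lt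
      (Set.ncard_lt_ncard ?_ (h _ h0))
    refine ⟨fun d hd => hd.trans (Associates.mk_dvd_mk.2 (dvd_mul_left _ _)), fun hsub => ?_⟩
    have h1 : Associates.mk (x * s.prod) ∣ Associates.mk s.prod := hsub (dvd_refl _)
    obtain ⟨c, hc⟩ := Associates.mk_dvd_mk.1 h1
    refine hs x (Multiset.mem_cons_self _ _) (IsUnit.of_mul_eq_one c ?_)
    apply mul_right_cancel₀ hs0
    rw [one_mul]
    nth_rewrite 2 [hc]
    ring

theorem isFFR_of_finite_divisors
    (h : ∀ a : A, a ≠ 0 → {d : Associates A | d ∣ Associates.mk a}.Finite) : IsFFR A := by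
  intro a ha _
  refine exists_finite_of_factors ((h a ha).image Quot.out)
    {d : Associates A | d ∣ Associates.mk a}.ncard ?_
  rintro s ⟨hs, rfl⟩
  refine ⟨card_le_ncard_divisors h s hs ha, fun x hx => ?_⟩
  refine ⟨_, ⟨Associates.mk x, Associates.mk_dvd_mk.2 (Multiset.dvd_prod hx), rfl⟩, ?_⟩
  refine (Associates.mk_eq_mk_iff_associated.1 ?_).assoc
  exact (Associates.quot_out _).symm

theorem isFFR_polynomial_of_isDomain (h : IsFFR A) : IsFFR A[X] := by
  apply isFFR_of_finite_divisors
  intro f hf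
  let K := FractionRing A
  let φ : A →+* K := algebraMap A K
  have hφ : Function.Injective φ := IsFractionRing.injective A K
  have hf' : f.map φ ≠ 0 := (Polynomial.map_ne_zero_iff hφ).2 hf
  refine Set.Finite.of_injOn
    (f := fun d : Associates A[X] => (Associates.mk (Quot.out d).leadingCoeff,
      Associates.mk ((Quot.out d).map φ))) (t := _ ×ˢ _) ?_ ?_
    ((h.finite_divisors (leadingCoeff_ne_zero.2 hf)).prod (finite_divisors_of_ufm hf'))
  · intro d hd
    have hd' : Quot.out d ∣ f := by
      rw [← Associates.mk_dvd_mk, Associates.quot_out]; exact hd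
    exact ⟨Associates.mk_dvd_mk.2 (map_dvd leadingCoeffHom hd'),
      Associates.mk_dvd_mk.2 (Polynomial.map_dvd φ hd')⟩
  · intro d hd e he hde
    have hd' : Quot.out d ∣ f := by
      rw [← Associates.mk_dvd_mk, Associates.quot_out]; exact hd
    rw [← Associates.quot_out d, ← Associates.quot_out e]
    beta_reduce at hde
    generalize Quot.out d = p at hde hd'
    generalize Quot.out e = q at hde
    obtain ⟨h1, h2⟩ := Prod.mk.inj hde
    obtain ⟨u, hu⟩ := Associates.mk_eq_mk_iff_associated.1 h1
    obtain ⟨v, hv⟩ := Associates.mk_eq_mk_iff_associated.1 h2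
    obtain ⟨k, -, hk⟩ := Polynomial.isUnit_iff.1 v.isUnit
    have hp : p.leadingCoeff ≠ 0 := leadingCoeff_ne_zero.2 (ne_zero_of_dvd_ne_zero hf hd')
    -- The scalar relating the two polynomials over `K` is read off from leading coefficients, hence
    -- comes from a unit of `A`.
    have hk' : k = φ u := by
      have := congrArg leadingCoeff hv
      rw [← hk, leadingCoeff_mul, leadingCoeff_C, leadingCoeff_map_of_injective hφ,
        leadingCoeff_map_of_injective hφ, ← hu, map_mul] at this
      exact mul_left_cancel₀ (by rwa [Ne, map_eq_zero_iff _ hφ]) this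
    refine Associates.mk_eq_mk_iff_associated.2 ⟨Units.map (C : A →+* A[X]).toMonoidHom u, ?_⟩
    apply Polynomial.map_injective φ hφ
    rw [← hv, ← hk, hk']
    simp

theorem isFFR_of_isFFR_polynomial (h : IsFFR A[X]) : IsFFR A := by
  apply isFFR_of_finite_divisors
  intro a ha
  refine Set.Finite.of_injOn (f := fun d : Associates A => Associates.mk (C (Quot.out d))) ?_ ?_
    (h.finite_divisors (C_ne_zero.2 ha))
  · intro d hd
    refine Associates.mk_dvd_mk.2 (map_dvd C ?_)
    rw [← Associates.mk_dvd_mk, Associates.quot_out]; exact hd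
  · intro d _ e _ hde
    rw [← Associates.quot_out d, ← Associates.quot_out e]
    have := (Associates.mk_eq_mk_iff_associated.1 hde).map (constantCoeff : A[X] →+* A)
    exact Associates.mk_eq_mk_iff_associated.2 (by simpa using this)

end Domain

/-! ### Finite présimplifiable rings are local with nilpotent maximal ideal. -/

section Nilpotent

variable {R : Type*} [CommRing R]

theorem IsPresimplifiable.isUnit_or_isNilpotent [Finite R] (h : IsPresimplifiable R) (r : R) :
    IsUnit r ∨ IsNilpotent r := by
  have key : ∀ i j : ℕ, i < j → r ^ i = r ^ j → IsUnit r ∨ IsNilpotent r := by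
    intro i j hij he
    by_cases h0 : r ^ i = 0
    · exact Or.inr ⟨i, h0⟩
    · have := h (r ^ i) (r ^ (j - i)) h0 (by rw [← pow_add, he]; congr 1; omega)
      exact Or.inl ((isUnit_pow_iff (by omega)).1 this)
  obtain ⟨i, j, hij, he⟩ := Finite.exists_ne_map_eq_of_infinite fun i : ℕ => r ^ i
  rcases lt_or_gt_of_ne hij with hlt | hlt
  · exact key i j hlt he
  · exact key j i hlt he.symm

theorem IsPresimplifiable.isLocalRing [Finite R] [Nontrivial R] (h : IsPresimplifiable R) :
    IsLocalRing R := by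
  refine IsLocalRing.of_nonunits_add fun a b ha hb => ?_
  have ha' := (h.isUnit_or_isNilpotent a).resolve_left ha
  have hb' := (h.isUnit_or_isNilpotent b).resolve_left hb
  exact ((Commute.all a b).isNilpotent_add ha' hb').not_isUnit

theorem exists_isNilpIndex [Finite R] [IsLocalRing R] :
    ∃ n, IsNilpIndex (IsLocalRing.maximalIdeal R) n := by
  classical
  have hex : ∃ n, IsLocalRing.maximalIdeal R ^ n = ⊥ := by
    have := IsArtinianRing.isNilpotent_jacobson_bot (R := R)
    rwa [IsLocalRing.jacobson_eq_maximalIdeal _ bot_ne_top] at this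
  have h0 : Nat.find hex ≠ 0 := by
    intro h0
    have := Nat.find_spec hex
    rw [h0, pow_zero, Ideal.one_eq_top] at this
    exact bot_ne_top this.symm
  exact ⟨Nat.find hex, by omega, Nat.find_spec hex, Nat.find_min hex (by omega)⟩

end Nilpotent

/-! ### Consequences of `R[X]` being an FFR. -/

section Necessity

variable {R : Type*} [CommRing R]

theorem IsPresimplifiable.of_polynomial (h : IsPresimplifiable R[X]) : IsPresimplifiable R := by
  intro a b ha hab
  exact isUnit_C.1 (h (C a) (C b) (C_ne_zero.2 ha) (by rw [← C_mul, ← hab]))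

theorem finite_annihilator [Nontrivial R] (h : IsFFR R[X]) {z : R} (hz : z ≠ 0)
    (hu : ¬ IsUnit z) : {p : R | z * p = 0}.Finite := by
  by_contra hinf
  have : Infinite {p : R | z * p = 0} := Set.infinite_coe_iff.2 hinf
  have ha : C z * X ≠ 0 := fun h0 => hz (by simpa using congrArg (coeff · 1) h0)
  obtain ⟨i, j, hij, hass⟩ := h.exists_assoc ha (mt isUnit_C.1 hu)
    (fun p : {p : R | z * p = 0} => X + C (p : R))
    (fun p => not_isUnit_X_add_C _)
    (fun p => by rw [mul_add, ← C_mul, p.2]; simp)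
  have := eq_of_monic_of_associated (monic_X_add_C _) (monic_X_add_C _)
    (h.isPresimplifiable.associated hass)
  exact hij (Subtype.ext (C_injective (add_left_cancel this)))

/-- Multiplication by `z` maps `R` into the finite annihilator of `w`, with fibres cosets of the
finite annihilator of `z`. -/
theorem finite_of_mul_eq_zero [Nontrivial R] (h : IsFFR R[X]) {z w : R} (hz : z ≠ 0)
    (hw : w ≠ 0) (hzw : z * w = 0) : Finite R := by
  have huz : ¬ IsUnit z := fun hu => hw (hu.mul_right_eq_zero.1 hzw)
  have huw : ¬ IsUnit w := fun hu => hz (hu.mul_left_eq_zero.1 hzw)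
  have hf := finite_annihilator h hz huz
  have hr := finite_annihilator h hw huw
  refine Set.finite_univ_iff.1 ((hr.preimage' (f := fun r => z * r) fun b _ => ?_).subset ?_)
  · rcases Set.eq_empty_or_nonempty ((fun r => z * r) ⁻¹' {b}) with he | ⟨r₀, hr₀⟩
    · rw [he]; exact Set.finite_empty
    · refine (hf.image (r₀ + ·)).subset fun r hr => ⟨r - r₀, ?_, by simp⟩
      simp only [Set.mem_preimage, Set.mem_singleton_iff] at hr hr₀
      simp [mul_sub, hr, hr₀]
  · intro r _
    simp only [Set.mem_preimage, Set.mem_ofPred_eq]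
    rw [← mul_assoc, mul_comm w, hzw, zero_mul]

variable [IsLocalRing R]

open IsLocalRing

/-- The polynomials `y + x X ^ (k + 1)` are divisors of `cy`, and they are pairwise nonassociate
unless `x ∈ y M`. -/
theorem exists_eq_mul_of_isFFR (h : IsFFR R[X]) {c x y : R} (hc : c ∈ maximalIdeal R)
    (hy : y ∈ maximalIdeal R) (hcx : c * x = 0) (hcy : c * y ≠ 0) :
    ∃ m ∈ maximalIdeal R, x = y * m := by
  by_contra! hcon
  have key : ∀ i j : ℕ, i < j →
      ¬ Assoc (C y + C x * X ^ (i + 1) : R[X]) (C y + C x * X ^ (j + 1)) := by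
    intro i j hij hass
    obtain ⟨u, hu⟩ := h.isPresimplifiable.associated hass
    have hnil : ∀ k, k ≠ 0 → (u : R[X]).coeff k ∈ maximalIdeal R := fun k hk =>
      ((isUnit_iff_coeff_isUnit_isNilpotent.1 u.isUnit).2 k hk).not_isUnit
    -- In degree `j + 1` this reads `y u_(j+1) + x u_(j-i) = x`. Nonconstant coefficients of a unit
    -- are nilpotent, so `1 - u_(j-i)` is a unit and can be divided out.
    have hco := congrArg (coeff · (j + 1)) hu
    simp only [add_mul, coeff_add, coeff_C_mul, mul_assoc, coeff_X_pow_mul', coeff_X_pow,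
      coeff_C_succ] at hco
    rw [if_pos (by omega), show j + 1 - (i + 1) = j - i by omega] at hco
    simp only [if_true, mul_one, zero_add] at hco
    have h1 := hnil (j + 1) (by omega)
    have h2 := hnil (j - i) (by omega)
    have h3 : IsUnit (1 - (u : R[X]).coeff (j - i)) := isUnit_one_sub_self_of_mem_nonunits _ h2
    obtain ⟨v, hv⟩ := h3
    refine hcon ((u : R[X]).coeff (j + 1) * ↑v⁻¹) (Ideal.mul_mem_right _ _ h1) ?_
    rw [← mul_assoc, Units.eq_mul_inv_iff_mul_eq, hv, mul_sub, mul_one, sub_eq_iff_eq_add]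
    exact hco.symm
  obtain ⟨i, j, hij, hass⟩ := h.exists_assoc (a := C (c * y)) (C_ne_zero.2 hcy)
    (c := C c) (fun hu => hc (isUnit_C.1 hu))
    (fun k : ℕ => C y + C x * X ^ (k + 1))
    (fun k hu => by
      have := (isUnit_iff_coeff_isUnit_isNilpotent.1 hu).1
      simp at this
      exact hy this)
    (fun k => by rw [mul_add, ← mul_assoc, ← C_mul, ← C_mul, hcx]; simp)
  rcases lt_or_gt_of_ne hij with hlt | hlt
  · exact key i j hlt hass
  · exact key j i hlt hass.symm

/-- Start from a nonzero element of `M ^ (n - 1)` and trade its factors in `M`, one at a time, for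
the `x i`. A trade that produced zero would put `x i` in `yM ⊆ M²`. -/
theorem exists_mul_ne_zero (h : IsFFR R[X]) {n : ℕ} (hn : IsNilpIndex (maximalIdeal R) n)
    (j : ℕ) : j < n → ∀ x : Fin j → R, (∀ i, x i ∈ maximalIdeal R ∧ x i ∉ maximalIdeal R ^ 2) →
      ∃ d ∈ maximalIdeal R ^ (n - 1 - j), (∏ i, x i) * d ≠ 0 := by
  induction j with
  | zero =>
    intro _ x _
    obtain ⟨d, hd, h0⟩ := Submodule.exists_mem_ne_zero_of_ne_bot hn.2.2
    exact ⟨d, by simpa using hd, by simpa using h0⟩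
  | succ j ih =>
    intro hj x hx
    obtain ⟨d, hd, h0⟩ := ih (by omega) (fun i => x i.castSucc) fun i => hx _
    rw [Fin.prod_univ_castSucc]
    set c := ∏ i : Fin j, x i.castSucc
    have hex : ∃ e ∈ maximalIdeal R ^ (n - 1 - (j + 1)), ∃ y ∈ maximalIdeal R,
        c * (e * y) ≠ 0 := by
      by_contra! hcon
      have hle : maximalIdeal R ^ (n - 1 - j) ≤ LinearMap.ker (LinearMap.mulLeft R c) := by
        rw [show n - 1 - j = n - 1 - (j + 1) + 1 by omega, pow_succ, Ideal.mul_le]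
        intro r hr s hs
        simpa using hcon r hr s hs
      exact h0 (by simpa using hle hd)
    obtain ⟨e, he, y, hy, hcey⟩ := hex
    refine ⟨e, he, fun hzero => ?_⟩
    have hxl := hx (Fin.last j)
    have hzero' : c * e * x (Fin.last j) = 0 := by rw [← hzero]; ring
    by_cases hce : c * e ∈ maximalIdeal R
    · obtain ⟨m, hm, hxm⟩ := exists_eq_mul_of_isFFR h hce hy hzero' (by rwa [mul_assoc])
      apply hxl.2
      rw [hxm, pow_two]
      exact Ideal.mul_mem_mul hy hm
    · rw [(notMem_maximalIdeal.1 hce).mul_right_eq_zero] at hzero'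
      exact hxl.2 (hzero' ▸ Ideal.zero_mem _)

theorem prod_mem_pow {S : Type*} [CommRing S] {I : Ideal S} {k : ℕ} {x : Fin k → S}
    (hx : ∀ i, x i ∈ I) : ∏ i, x i ∈ I ^ k := by
  simpa using Ideal.prod_mem_prod (s := Finset.univ) (I := fun _ => I) fun i _ => hx i

theorem condA_of_isFFR (h : IsFFR R[X]) {n : ℕ} (hn : IsNilpIndex (maximalIdeal R) n) :
    CondA (maximalIdeal R) n := by
  intro k _ hk x hx
  refine ⟨prod_mem_pow fun i => (hx i).1, fun hmem => ?_⟩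
  obtain ⟨d, hd, h0⟩ := exists_mul_ne_zero h hn k hk x hx
  have := Ideal.mul_mem_mul hmem hd
  rw [← pow_add, show k + 1 + (n - 1 - k) = n by omega, hn.2.1] at this
  exact h0 this

theorem condB_of_isFFR (h : IsFFR R[X]) {n : ℕ} (hn : IsNilpIndex (maximalIdeal R) n) :
    CondB (maximalIdeal R) := by
  intro a ha ha2
  apply le_antisymm
  · rw [pow_two]
    exact Ideal.mul_mono_left ((Ideal.span_singleton_le_iff_mem _).2 ha)
  · intro m hm
    rw [Ideal.mem_span_singleton_mul]
    rcases le_or_gt n 2 with h2 | h2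
    · have : m = 0 := by
        have := Ideal.pow_le_pow_right h2 hm
        rwa [hn.2.1] at this
      exact ⟨0, Ideal.zero_mem _, by simp [this]⟩
    -- With `c = a ^ (n - 2)`, `c` kills `M²` while `c * a = a ^ (n - 1)` is nonzero by (a); the
    -- exchange principle then gives `m ∈ aM`.
    · have h1 := (condA_of_isFFR h hn (n - 1) (by omega) (by omega) (fun _ => a)
        fun _ => ⟨ha, ha2⟩).2
      have hc := Ideal.pow_mem_pow ha (n - 2)
      obtain ⟨m', hm', he⟩ := exists_eq_mul_of_isFFR h (c := a ^ (n - 2)) (x := m) (y := a)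
        (Ideal.pow_le_self (by omega) hc) ha
        (by
          have := Ideal.mul_mem_mul hc hm
          rw [← pow_add, show n - 2 + 2 = n by omega, hn.2.1] at this
          exact this)
        (by
          intro h0
          rw [← pow_succ, show n - 2 + 1 = n - 1 by omega] at h0
          exact h1 (by simp [h0]))
      exact ⟨m', hm', he.symm⟩

end Necessity

theorem coeff_mul_mem_pow {R : Type*} [CommRing R] {f g : R[X]} {I : Ideal R} {i j : ℕ}
    (hf : ∀ k, f.coeff k ∈ I ^ i)
    (hg : ∀ k, g.coeff k ∈ I ^ j) (k : ℕ) : (f * g).coeff k ∈ I ^ (i + j) := by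
  rw [coeff_mul]
  refine Ideal.sum_mem _ fun x _ => ?_
  rw [pow_add]
  exact Ideal.mul_mem_mul (hf _) (hg _)

/-! ### Orders of polynomials and division over a local ring. -/

section Local

open IsLocalRing

variable {R : Type*} [CommRing R] [IsLocalRing R] {n : ℕ}

theorem exists_mem_notMem_sq (hn : IsNilpIndex (maximalIdeal R) n) (h2 : 2 ≤ n) :
    ∃ a ∈ maximalIdeal R, a ∉ maximalIdeal R ^ 2 := by
  by_contra! hcon
  apply hn.2.2
  have hle : maximalIdeal R ≤ maximalIdeal R ^ 2 := hcon
  rw [eq_bot_iff, ← hn.2.1, show n - 1 = n - 2 + 1 by omega, pow_succ]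
  refine (Ideal.mul_mono_right hle).trans ?_
  rw [← pow_add, show n - 2 + 2 = n by omega]

theorem CondB.span_pow_mul (hB : CondB (maximalIdeal R)) {a : R} (ha : a ∈ maximalIdeal R)
    (ha2 : a ∉ maximalIdeal R ^ 2) (i : ℕ) :
    Ideal.span {a ^ i} * maximalIdeal R = maximalIdeal R ^ (i + 1) := by
  induction i with
  | zero => simp
  | succ i ih =>
    rw [pow_succ (maximalIdeal R), ← ih, mul_assoc, ← pow_two, ← hB a ha ha2, ← mul_assoc,
      Ideal.span_singleton_mul_span_singleton, pow_succ]

theorem CondB.exists_eq_pow_mul (hB : CondB (maximalIdeal R)) {a : R}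
    (ha : a ∈ maximalIdeal R) (ha2 : a ∉ maximalIdeal R ^ 2) {i : ℕ} {x : R}
    (hx : x ∈ maximalIdeal R ^ (i + 1)) (hx' : x ∉ maximalIdeal R ^ (i + 2)) :
    ∃ y ∈ maximalIdeal R, y ∉ maximalIdeal R ^ 2 ∧ x = a ^ i * y := by
  rw [← hB.span_pow_mul ha ha2, Ideal.mem_span_singleton_mul] at hx
  obtain ⟨y, hy, rfl⟩ := hx
  refine ⟨y, hy, fun h2 => hx' ?_, rfl⟩
  rw [pow_add]
  exact Ideal.mul_mem_mul (Ideal.pow_mem_pow ha i) h2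

theorem isUnit_of_notMem_pow_one {x : R} (hx : x ∉ maximalIdeal R ^ (0 + 1)) : IsUnit x := by
  rwa [zero_add, pow_one, notMem_maximalIdeal] at hx

theorem CondA.condA' (hn : IsNilpIndex (maximalIdeal R) n) (hB : CondB (maximalIdeal R))
    (hA : CondA (maximalIdeal R) n) : CondA' (maximalIdeal R) n := by
  intro i j hij x y hx hx' hy hy'
  rcases i with _ | i
  · have hu := isUnit_of_notMem_pow_one hx'
    rw [zero_add, Ideal.unit_mul_mem_iff_mem _ hu, Ideal.unit_mul_mem_iff_mem _ hu]
    exact ⟨hy, hy'⟩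
  rcases j with _ | j
  · have hu := isUnit_of_notMem_pow_one hy'
    rw [add_zero, Ideal.mul_unit_mem_iff_mem _ hu, Ideal.mul_unit_mem_iff_mem _ hu]
    exact ⟨hx, hx'⟩
  obtain ⟨a, ha, ha2⟩ := exists_mem_notMem_sq hn (by omega)
  obtain ⟨x, hxM, hx2, rfl⟩ := hB.exists_eq_pow_mul ha ha2 hx hx'
  obtain ⟨y, hyM, hy2, rfl⟩ := hB.exists_eq_pow_mul ha ha2 hy hy'
  -- By (b) the two elements are `a ^ i * x` and `a ^ j * y` with `x, y ∈ M \ M²`, so (a) applies to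
  -- the list `x, y, a, …, a` of length `i + j + 2`.
  have := hA (i + j + 1 + 1) (by omega) (by omega)
    (Fin.cons x (Fin.cons y fun _ => a : Fin (i + j + 1) → R)) (by
      intro k
      refine Fin.cases ?_ (fun k => ?_) k
      · exact ⟨hxM, hx2⟩
      · refine Fin.cases ?_ (fun k => ?_) k
        · exact ⟨hyM, hy2⟩
        · exact ⟨ha, ha2⟩)
  simp only [Fin.prod_univ_succ, Fin.cons_zero, Fin.cons_succ, Finset.prod_const,
    Finset.card_univ, Fintype.card_fin] at this
  rw [show a ^ i * x * (a ^ j * y) = x * (y * a ^ (i + j)) by ring,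
    show i + 1 + (j + 1) = i + j + 1 + 1 by ring]
  exact this

theorem CondA'.condA (hA : CondA' (maximalIdeal R) n) : CondA (maximalIdeal R) n := by
  intro k _
  induction k with
  | zero => omega
  | succ k ih =>
    intro hk x hx
    rw [Fin.prod_univ_castSucc]
    have hl := hx (Fin.last k)
    have hp : ∏ i : Fin k, x i.castSucc ∈ maximalIdeal R ^ k ∧
        ∏ i : Fin k, x i.castSucc ∉ maximalIdeal R ^ (k + 1) := by
      rcases Nat.eq_zero_or_pos k with rfl | hk0
      · simp [Ideal.one_eq_top]
      · exact ih hk0 (by omega) _ fun i => hx _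
    exact hA k 1 hk _ _ hp.1 hp.2 (by simpa using hl.1) hl.2

/-- This is what makes division possible: a coefficient of order exactly `i` divides every element
of `M ^ (i + 1)`, with quotient in the expected power of `M`. -/
theorem CondB.span_mul_pow (hn : IsNilpIndex (maximalIdeal R) n) (hB : CondB (maximalIdeal R))
    {i : ℕ} (hi : i < n) {c : R} (hc : c ∈ maximalIdeal R ^ i)
    (hc' : c ∉ maximalIdeal R ^ (i + 1)) (t : ℕ) :
    Ideal.span {c} * maximalIdeal R ^ (t + 1) = maximalIdeal R ^ (i + 1 + t) := by
  have h1 : Ideal.span {c} * maximalIdeal R = maximalIdeal R ^ (i + 1) := by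
    rcases i with _ | i
    · rw [Ideal.span_singleton_eq_top.2 (isUnit_of_notMem_pow_one hc'), Ideal.top_mul]
      simp
    · obtain ⟨a, ha, ha2⟩ := exists_mem_notMem_sq hn (by omega)
      obtain ⟨c, hcM, hc2, rfl⟩ := hB.exists_eq_pow_mul ha ha2 hc hc'
      rw [← Ideal.span_singleton_mul_span_singleton, mul_assoc, hB c hcM hc2, pow_two, ← mul_assoc,
        hB.span_pow_mul ha ha2, ← pow_succ]
  rw [pow_succ', ← mul_assoc, h1, ← pow_add]

/-- `i` is the largest power of `M` containing all coefficients of `f`, and `d` is the degree of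
`f` modulo `M ^ (i + 1)`. -/
def HasOrder (f : R[X]) (i d : ℕ) : Prop :=
  (∀ k, f.coeff k ∈ maximalIdeal R ^ i) ∧ f.coeff d ∉ maximalIdeal R ^ (i + 1) ∧
    ∀ k, d < k → f.coeff k ∈ maximalIdeal R ^ (i + 1)

theorem exists_hasOrder (hn : IsNilpIndex (maximalIdeal R) n) {f : R[X]} (hf : f ≠ 0) :
    ∃ i d, HasOrder f i d := by
  classical
  have hex : ∃ i, ¬ ∀ k, f.coeff k ∈ maximalIdeal R ^ (i + 1) := by
    refine ⟨n, fun hcon => hf ?_⟩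
    ext k
    have := Ideal.pow_le_pow_right (Nat.le_succ n) (hcon k)
    rwa [hn.2.1] at this
  have hmem : ∀ k, f.coeff k ∈ maximalIdeal R ^ Nat.find hex := by
    rcases hi : Nat.find hex with _ | i
    · simp [Ideal.one_eq_top]
    · exact not_not.1 (Nat.find_min hex (m := i) (by omega))
  have hspec := Nat.find_spec hex
  obtain ⟨k, hk⟩ := not_forall.1 hspec
  have hne : ∀ k, f.coeff k ∉ maximalIdeal R ^ (Nat.find hex + 1) → k ≤ f.natDegree :=
    fun k hk => le_natDegree_of_ne_zero fun h0 => hk (by rw [h0]; exact Ideal.zero_mem _)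
  refine ⟨Nat.find hex, Nat.findGreatest
    (fun k => f.coeff k ∉ maximalIdeal R ^ (Nat.find hex + 1)) f.natDegree, hmem,
    Nat.findGreatest_spec (P := fun k => f.coeff k ∉ maximalIdeal R ^ (Nat.find hex + 1))
      (hne k hk) hk, fun l hl => ?_⟩
  by_contra hcon
  exact absurd (Nat.le_findGreatest (P := fun k => f.coeff k ∉ maximalIdeal R ^ (Nat.find hex + 1))
    (hne l hcon) hcon) (by omega)

theorem HasOrder.lt {f : R[X]} {i d : ℕ} (hn : IsNilpIndex (maximalIdeal R) n)
    (h : HasOrder f i d) : i < n := by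
  by_contra hcon
  have h0 := Ideal.pow_le_pow_right (not_lt.1 hcon) (h.1 d)
  rw [hn.2.1] at h0
  exact h.2.1 (by rw [(Ideal.mem_bot).1 h0]; exact Ideal.zero_mem _)

theorem HasOrder.unique {f : R[X]} {i d j e : ℕ} (h : HasOrder f i d) (h' : HasOrder f j e) :
    i = j ∧ d = e := by
  have hij : i = j := by
    rcases lt_trichotomy i j with hlt | heq | hlt
    · exact absurd (Ideal.pow_le_pow_right hlt (h'.1 d)) h.2.1
    · exact heq
    · exact absurd (Ideal.pow_le_pow_right hlt (h.1 e)) h'.2.1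
  subst hij
  refine ⟨rfl, ?_⟩
  rcases lt_trichotomy d e with hlt | heq | hlt
  · exact absurd (h.2.2 e hlt) h'.2.1
  · exact heq
  · exact absurd (h'.2.2 d hlt) h.2.1

theorem HasOrder.mul {f g : R[X]} {i d j e : ℕ} (hn : IsNilpIndex (maximalIdeal R) n)
    (hA : CondA' (maximalIdeal R) n) (hf : HasOrder f i d) (hg : HasOrder g j e)
    (h0 : f * g ≠ 0) : HasOrder (f * g) (i + j) (d + e) := by
  have hmem := coeff_mul_mem_pow hf.1 hg.1
  have hlt : i + j < n := by
    by_contra hcon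
    apply h0
    ext k
    have := Ideal.pow_le_pow_right (not_lt.1 hcon) (hmem k)
    rwa [hn.2.1] at this
  have hterm : ∀ a b, d < a ∨ e < b →
      f.coeff a * g.coeff b ∈ maximalIdeal R ^ (i + j + 1) := by
    rintro a b (h | h)
    · rw [show i + j + 1 = i + 1 + j by ring, pow_add]
      exact Ideal.mul_mem_mul (hf.2.2 a h) (hg.1 b)
    · rw [add_assoc, pow_add]
      exact Ideal.mul_mem_mul (hf.1 a) (hg.2.2 b h)
  refine ⟨hmem, fun hcon => ?_, fun k hk => ?_⟩
  · apply (hA i j hlt _ _ (hf.1 d) hf.2.1 (hg.1 e) hg.2.1).2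
    -- As for products of leading terms: only the pair `(d, e)` contributes modulo `M ^ (i + j +
    -- 1)`.
    rw [coeff_mul, ← Finset.add_sum_erase _ _ (Finset.HasAntidiagonal.mem_antidiagonal.2
      (rfl : (d, e).1 + (d, e).2 = d + e))] at hcon
    refine (Ideal.add_mem_iff_left _ (Ideal.sum_mem _ fun x hx => ?_)).1 hcon
    obtain ⟨hne, hx⟩ := Finset.mem_erase.1 hx
    rw [Finset.HasAntidiagonal.mem_antidiagonal] at hx
    refine hterm _ _ ?_
    by_contra! hle
    exact hne (Prod.ext (by simp; omega) (by simp; omega))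
  · rw [coeff_mul]
    refine Ideal.sum_mem _ fun x hx => hterm _ _ ?_
    rw [Finset.HasAntidiagonal.mem_antidiagonal] at hx
    omega

theorem isNilpotent_of_mem_maximalIdeal (hn : IsNilpIndex (maximalIdeal R) n) {x : R}
    (hx : x ∈ maximalIdeal R) : IsNilpotent x := by
  have := Ideal.pow_mem_pow hx n
  rw [hn.2.1] at this
  exact ⟨n, this⟩

theorem HasOrder.isUnit {f : R[X]} (hn : IsNilpIndex (maximalIdeal R) n) (h : HasOrder f 0 0) :
    IsUnit f :=
  isUnit_iff_coeff_isUnit_isNilpotent.2 ⟨isUnit_of_notMem_pow_one h.2.1, fun k hk =>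
    isNilpotent_of_mem_maximalIdeal hn (by simpa using h.2.2 k (Nat.pos_of_ne_zero hk))⟩

/-- Division by a polynomial whose leading coefficient lies in `M ^ i \ M ^ (i + 1)`. -/
theorem exists_div (hn : IsNilpIndex (maximalIdeal R) n) (hB : CondB (maximalIdeal R))
    {p : R[X]} {i d : ℕ} (hi : i < n) (hp : ∀ k, p.coeff k ∈ maximalIdeal R ^ i)
    (hpd : p.coeff d ∉ maximalIdeal R ^ (i + 1)) (hp0 : ∀ k, d < k → p.coeff k = 0) (t N : ℕ) :
    ∀ h : R[X], (∀ k, h.coeff k ∈ maximalIdeal R ^ (i + 1 + t)) →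
      (∀ k, d + N ≤ k → h.coeff k = 0) →
      ∃ w : R[X], (∀ k, w.coeff k ∈ maximalIdeal R ^ (t + 1)) ∧
        ∀ k, d ≤ k → (h - w * p).coeff k = 0 := by
  induction N with
  | zero => exact fun h _ hh => ⟨0, by simp, fun k hk => by simpa using hh k hk⟩
  | succ N ih =>
    intro h hmem hh
    have hN := hmem (d + N)
    rw [← hB.span_mul_pow hn hi (hp d) hpd t, Ideal.mem_span_singleton_mul] at hN
    -- Subtracting `b X ^ N p` kills the top coefficient, in degree `d + N`.
    obtain ⟨b, hb, hbN⟩ := hN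
    have hq : ∀ k, (C b * X ^ N : R[X]).coeff k ∈ maximalIdeal R ^ (t + 1) := by
      intro k
      rw [coeff_C_mul_X_pow]
      split_ifs
      · exact hb
      · exact Ideal.zero_mem _
    obtain ⟨w, hw, hwk⟩ := ih (h - C b * X ^ N * p) (fun k => by
        rw [coeff_sub]
        refine Ideal.sub_mem _ (hmem k) ?_
        have := coeff_mul_mem_pow hq hp k
        rwa [show t + 1 + i = i + 1 + t by ring] at this) (fun k hk => by
        rw [coeff_sub, mul_assoc, coeff_C_mul, coeff_X_pow_mul', if_pos (by omega)]
        rcases hk.eq_or_lt with rfl | hlt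
        · rw [show d + N - N = d by omega, ← hbN, mul_comm, sub_self]
        · rw [hh k (by omega), hp0 _ (by omega), mul_zero, sub_zero])
    refine ⟨C b * X ^ N + w, fun k => ?_, fun k hk => ?_⟩
    · rw [coeff_add]
      exact Ideal.add_mem _ (hq k) (hw k)
    · rw [add_mul, ← sub_sub]
      exact hwk k hk

/-- Successive approximation in the style of Weierstrass preparation: each multiplication by a unit
`1 - w` pushes the tail beyond degree `d` one power of `M` deeper. -/
theorem HasOrder.exists_isUnit_mul_coeff_mem (hn : IsNilpIndex (maximalIdeal R) n)
    (hB : CondB (maximalIdeal R)) {f : R[X]} {i d : ℕ} (h : HasOrder f i d) (t : ℕ) :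
    ∃ u : R[X], IsUnit u ∧ (∀ k, (u * f).coeff k ∈ maximalIdeal R ^ i) ∧
      (u * f).coeff d ∉ maximalIdeal R ^ (i + 1) ∧
      ∀ k, d < k → (u * f).coeff k ∈ maximalIdeal R ^ (i + 1 + t) := by
  induction t with
  | zero => exact ⟨1, isUnit_one, by simpa using h.1, by simpa using h.2.1, by simpa using h.2.2⟩
  | succ t ih =>
    obtain ⟨u, hu, h1, h2, h3⟩ := ih
    set g := u * f with hg
    obtain ⟨p, hp⟩ : ∃ p : R[X], ∀ k, p.coeff k = if k ≤ d then g.coeff k else 0 := by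
      refine ⟨∑ k ∈ Finset.range (d + 1), C (g.coeff k) * X ^ k, fun k => ?_⟩
      simp [coeff_X_pow]
    have hh : ∀ k, (g - p).coeff k ∈ maximalIdeal R ^ (i + 1 + t) := by
      intro k
      rw [coeff_sub, hp]
      split_ifs with hk
      · simp
      · simpa using h3 k (not_le.1 hk)
    obtain ⟨w, hw, hwk⟩ := exists_div hn hB (h.lt hn) (p := p) (d := d)
      (fun k => by
        rw [hp]
        split_ifs
        · exact h1 k
        · exact Ideal.zero_mem _)
      (by rwa [hp, if_pos le_rfl]) (fun k hk => by rw [hp, if_neg (not_le.2 hk)]) t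
      (g.natDegree + 1) (g - p) hh (fun k hk => by
        have h0 : g.coeff k = 0 := coeff_eq_zero_of_natDegree_lt (by omega)
        rw [coeff_sub, hp, h0]; simp)
    have hwg := coeff_mul_mem_pow hw h1
    refine ⟨(1 - w) * u, IsUnit.mul ?_ hu, fun k => ?_, fun hcon => ?_, fun k hk => ?_⟩
    · refine IsNilpotent.isUnit_one_sub (Polynomial.isNilpotent_iff.2 fun k => ?_)
      exact isNilpotent_of_mem_maximalIdeal hn (Ideal.pow_le_self (Nat.succ_ne_zero t) (hw k))
    · rw [mul_assoc, ← hg, sub_mul, one_mul, coeff_sub]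
      exact Ideal.sub_mem _ (h1 k) (Ideal.pow_le_pow_right (by omega) (hwg k))
    · rw [mul_assoc, ← hg, sub_mul, one_mul, coeff_sub] at hcon
      exact h2 ((Submodule.sub_mem_iff_left _ (Ideal.pow_le_pow_right (by omega) (hwg d))).1 hcon)
    -- Above degree `d`, `p` vanishes and so does `g - p - w * p`; what remains is `w * (g - p)`,
    -- lying in a higher power of `M`.
    · have he : (1 - w) * u * f = p + (g - p - w * p) - w * (g - p) := by rw [hg]; ring
      rw [he, coeff_sub, coeff_add, hwk k hk.le, hp, if_neg (not_le.2 hk), add_zero, zero_sub,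
        Ideal.neg_mem_iff]
      exact Ideal.pow_le_pow_right (by omega) (coeff_mul_mem_pow hw hh k)

theorem HasOrder.exists_assoc_natDegree_le (hn : IsNilpIndex (maximalIdeal R) n)
    (hB : CondB (maximalIdeal R)) {f : R[X]} {i d : ℕ} (h : HasOrder f i d) :
    ∃ g : R[X], g.natDegree ≤ d ∧ Assoc f g := by
  obtain ⟨u, hu, -, -, h3⟩ := h.exists_isUnit_mul_coeff_mem hn hB n
  refine ⟨u * f, natDegree_le_iff_coeff_eq_zero.2 fun k hk => ?_, dvd_mul_left _ _,
    (hu.dvd_mul_left.1 dvd_rfl : u * f ∣ f)⟩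
  have := Ideal.pow_le_pow_right (by omega : n ≤ i + 1 + n) (h3 k hk)
  rwa [hn.2.1] at this

theorem finite_natDegree_le {S : Type*} [CommRing S] [Finite S] (d : ℕ) :
    {p : S[X] | p.natDegree ≤ d}.Finite := by
  refine Set.Finite.of_injOn (f := fun p (k : Fin (d + 1)) => p.coeff k) (t := Set.univ)
    (fun _ _ => Set.mem_univ _) (fun p hp q hq hpq => ?_) Set.finite_univ
  ext k
  rcases lt_or_ge k (d + 1) with hk | hk
  · exact congrFun hpq ⟨k, hk⟩
  · rw [coeff_eq_zero_of_natDegree_lt (lt_of_le_of_lt hp hk),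
      coeff_eq_zero_of_natDegree_lt (lt_of_le_of_lt hq hk)]

theorem HasOrder.card_le_and_factors (hn : IsNilpIndex (maximalIdeal R) n)
    (hA : CondA' (maximalIdeal R) n) (s : Multiset R[X]) :
    ∀ i d, HasOrder s.prod i d → (∀ x ∈ s, ¬ IsUnit x) → s.prod ≠ 0 →
      s.card ≤ i + d ∧ ∀ x ∈ s, ∃ j e, e ≤ d ∧ HasOrder x j e := by
  induction s using Multiset.induction_on with
  | empty => simp
  | cons x s ih =>
    intro i d h hs h0
    rw [Multiset.prod_cons] at h h0
    obtain ⟨j, e, hx⟩ := exists_hasOrder hn (left_ne_zero_of_mul h0)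
    obtain ⟨j', e', hs'⟩ := exists_hasOrder hn (right_ne_zero_of_mul h0)
    obtain ⟨rfl, rfl⟩ := h.unique (hx.mul hn hA hs' h0)
    obtain ⟨hcard, hfac⟩ := ih j' e' hs' (fun y hy => hs y (Multiset.mem_cons_of_mem hy))
      (right_ne_zero_of_mul h0)
    -- Order `(0, 0)` means unit, so every nonunit factor adds at least one to `i + d`.
    have hpos : j ≠ 0 ∨ e ≠ 0 := by
      by_contra! hcon
      obtain ⟨rfl, rfl⟩ := hcon
      exact hs x (Multiset.mem_cons_self _ _) (hx.isUnit hn)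
    refine ⟨by rw [Multiset.card_cons]; omega, fun y hy => ?_⟩
    rcases Multiset.mem_cons.1 hy with rfl | hy
    · exact ⟨j, e, by omega, hx⟩
    · obtain ⟨k, l, hl, hkl⟩ := hfac y hy
      exact ⟨k, l, by omega, hkl⟩

theorem isFFR_polynomial_of_isLocalRing [Finite R] (hn : IsNilpIndex (maximalIdeal R) n)
    (hA : CondA (maximalIdeal R) n) (hB : CondB (maximalIdeal R)) : IsFFR R[X] := by
  intro f hf _
  obtain ⟨i, d, h⟩ := exists_hasOrder hn hf
  refine exists_finite_of_factors (finite_natDegree_le d) (i + d) ?_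
  rintro s ⟨hs, rfl⟩
  obtain ⟨hcard, hfac⟩ := HasOrder.card_le_and_factors hn (hA.condA' hn hB) s i d h hs hf
  refine ⟨hcard, fun x hx => ?_⟩
  obtain ⟨j, e, he, hje⟩ := hfac x hx
  obtain ⟨g, hg, hxg⟩ := hje.exists_assoc_natDegree_le hn hB
  exact ⟨g, hg.trans he, hxg⟩

end Local

/-! ### Unique factorization rings. -/

section UFR

variable {R : Type*} [CommRing R]

/-- If `x = xy`, appending a factorization of `y` to one of `x` contradicts uniqueness of length. -/
theorem IsUFR.isPresimplifiable (h : IsUFR R) : IsPresimplifiable R := by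
  obtain ⟨α, β, hex, huniq⟩ := h
  intro x y hx hxy
  by_contra hy
  have hux : ¬ IsUnit x := fun hu => hy (by
    have : y = 1 := hu.mul_left_cancel (by rw [mul_one]; exact hxy.symm)
    rw [this]; exact isUnit_one)
  have hy0 : y ≠ 0 := fun h0 => hx (by rw [hxy, h0, mul_zero])
  obtain ⟨s, hs, hsx⟩ := hex x hx hux
  obtain ⟨t, ht, hty⟩ := hex y hy0 hy
  have := Multiset.card_eq_card_of_rel (huniq x hx hux s (s + t) hs hsx
    (fun z hz => (Multiset.mem_add.1 hz).elim (hs z) (ht z))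
    (by rw [Multiset.prod_add, hsx, hty, ← hxy]))
  have ht0 : t = 0 := by simpa using this
  exact hy (by rw [← hty, ht0]; simp)

theorem IsPresimplifiable.assocRel (h : IsPresimplifiable R) (β : AssocKind) {a b : R}
    (ha : a ≠ 0) (hab : Associated a b) : AssocRel β a b := by
  have hass := hab.assoc
  obtain ⟨u, rfl⟩ := hab
  cases β with
  | assoc => exact hass
  | strong => exact ⟨(u⁻¹ : Rˣ), Units.isUnit _, by rw [mul_comm a, Units.inv_mul_cancel_left]⟩
  | veryStrong =>
    refine ⟨hass, Or.inr ⟨ha, fun r hr => ?_⟩⟩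
    exact isUnit_of_mul_isUnit_right (x := (u : R)) (h a (u * r) ha (by
      nth_rewrite 1 [hr]; ring))

theorem AssocRel.assoc {β : AssocKind} {a b : R} (hab : AssocRel β a b) : Assoc a b := by
  cases β with
  | assoc => exact hab
  | strong =>
    obtain ⟨u, hu, rfl⟩ := hab
    exact ⟨hu.mul_left_dvd.2 dvd_rfl, dvd_mul_left _ _⟩
  | veryStrong => exact hab.1

theorem IsPresimplifiable.irredWith_iff (h : IsPresimplifiable R) (β : AssocKind) {a : R}
    (ha : a ≠ 0) : IrredWith (AssocRel β) a ↔ Irreducible a := by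
  have key : ∀ b c : R, a = b * c → AssocRel β a b → IsUnit c := by
    intro b c hbc hab
    obtain ⟨d, hd⟩ := hab.assoc.1
    exact isUnit_of_mul_isUnit_right (x := d) (h a (d * c) ha (by
      rw [← mul_assoc, ← hd, ← hbc]))
  refine ⟨fun hi => ⟨hi.1, fun b c hbc => ?_⟩, fun hi => ⟨hi.not_isUnit, fun b c hbc => ?_⟩⟩
  · exact (hi.2 b c hbc).elim (fun hab => Or.inr (key b c hbc hab))
      fun hac => Or.inl (key c b (by rw [hbc, mul_comm]) hac)
  · rcases hi.isUnit_or_isUnit hbc with hu | hu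
    · refine Or.inr (h.assocRel β ha (Associated.symm ⟨hu.unit, ?_⟩))
      rw [hbc, mul_comm, IsUnit.unit_spec]
    · exact Or.inl (h.assocRel β ha (Associated.symm ⟨hu.unit, hbc.symm⟩))

theorem IsPresimplifiable.mIrred_iff (h : IsPresimplifiable R) {a : R} (ha : a ≠ 0) :
    MIrred a ↔ Irreducible a := by
  refine ⟨fun hi => ⟨hi.1, fun b c hbc => ?_⟩, fun hi => ⟨hi.not_isUnit, ⟨?_, a, rfl⟩, ?_⟩⟩
  · by_contra! hcon
    have hle : Ideal.span {b} ≤ Ideal.span {a} := hi.2.2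
      ⟨mt Ideal.span_singleton_eq_top.1 hcon.1, b, rfl⟩
      (Ideal.span_singleton_le_span_singleton.2 ⟨c, hbc⟩)
    obtain ⟨d, hd⟩ := Ideal.span_singleton_le_span_singleton.1 hle
    exact hcon.2 (isUnit_of_mul_isUnit_right (x := d) (h a (d * c) ha (by
      rw [← mul_assoc, ← hd, ← hbc])))
  · exact mt Ideal.span_singleton_eq_top.1 hi.not_isUnit
  · rintro _ ⟨hb, b, rfl⟩ hle
    obtain ⟨c, hc⟩ := Ideal.span_singleton_le_span_singleton.1 hle
    have hu := (hi.isUnit_or_isUnit hc).resolve_left (mt Ideal.span_singleton_eq_top.2 hb)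
    rw [Ideal.span_singleton_le_span_singleton, hc, hu.mul_right_dvd]

theorem IsPresimplifiable.isIrred_iff (h : IsPresimplifiable R) (α : IrredKind) {a : R}
    (ha : a ≠ 0) : IsIrred α a ↔ Irreducible a := by
  cases α with
  | irred => exact h.irredWith_iff .assoc ha
  | strong => exact h.irredWith_iff .strong ha
  | maximal => exact h.mIrred_iff ha
  | veryStrong => exact h.irredWith_iff .veryStrong ha

theorem ne_zero_of_mem_of_prod_ne_zero {s : Multiset R} (hs : s.prod ≠ 0) {x : R} (hx : x ∈ s) :
    x ≠ 0 :=
  fun h0 => hs (Multiset.prod_eq_zero (h0 ▸ hx))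

theorem IsUFR.exists_irreducible_factors (h : IsUFR R) {a : R} (ha : a ≠ 0) (hu : ¬ IsUnit a) :
    ∃ s : Multiset R, (∀ x ∈ s, Irreducible x) ∧ s.prod = a := by
  have hp := h.isPresimplifiable
  obtain ⟨α, β, hex, -⟩ := h
  obtain ⟨s, hs, rfl⟩ := hex a ha hu
  exact ⟨s, fun x hx => (hp.isIrred_iff α (ne_zero_of_mem_of_prod_ne_zero ha hx)).1 (hs x hx), rfl⟩

theorem IsUFR.rel_associated (h : IsUFR R) {s t : Multiset R} (hs : ∀ x ∈ s, Irreducible x)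
    (ht : ∀ x ∈ t, Irreducible x) (hst : s.prod = t.prod) (h0 : s.prod ≠ 0)
    (hu : ¬ IsUnit s.prod) : Multiset.Rel Associated s t := by
  have hp := h.isPresimplifiable
  obtain ⟨α, β, -, huniq⟩ := h
  refine (huniq _ h0 hu s t (fun x hx => ?_) rfl (fun x hx => ?_) hst.symm).mono
    fun a _ b _ hab => hp.associated hab.assoc
  · exact (hp.isIrred_iff α (ne_zero_of_mem_of_prod_ne_zero h0 hx)).2 (hs x hx)
  · exact (hp.isIrred_iff α (ne_zero_of_mem_of_prod_ne_zero (hst ▸ h0) hx)).2 (ht x hx)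

theorem IsUFR.exists_irreducible_dvd (h : IsUFR R) {a : R} (ha : a ≠ 0) (hu : ¬ IsUnit a) :
    ∃ p, Irreducible p ∧ p ∣ a := by
  obtain ⟨s, hs, rfl⟩ := h.exists_irreducible_factors ha hu
  obtain ⟨p, hp⟩ := Multiset.exists_mem_of_ne_zero (s := s) (fun h0 => hu (by simp [h0]))
  exact ⟨p, hs p hp, Multiset.dvd_prod hp⟩

/-- An irreducible divisor of `a` is associated to a member of each factorization of `a` into
irreducibles. -/
theorem IsUFR.exists_mem_associated (h : IsUFR R) {q : R} {t : Multiset R} (hq : Irreducible q)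
    (ht : ∀ x ∈ t, Irreducible x) (h0 : t.prod ≠ 0) (hqt : q ∣ t.prod) :
    ∃ p ∈ t, Associated q p := by
  obtain ⟨c, hc⟩ := hqt
  have hu : ¬ IsUnit t.prod := fun hu => hq.not_isUnit (isUnit_of_mul_isUnit_left (hc ▸ hu))
  by_cases huc : IsUnit c
  · have hass : Associated q (q * c) := ⟨huc.unit, rfl⟩
    have hrel := h.rel_associated (s := {q * c}) (t := t)
      (by simpa using hass.irreducible hq) ht (by simp [hc]) (by simpa [← hc] using h0)
      (by simpa [← hc] using hu)
    obtain ⟨p, hp, hqp⟩ := Multiset.exists_mem_of_rel_of_mem hrel (Multiset.mem_singleton_self _)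
    exact ⟨p, hp, hass.trans hqp⟩
  · obtain ⟨s, hs, rfl⟩ := h.exists_irreducible_factors
      (fun hc0 => h0 (by rw [hc, hc0, mul_zero])) huc
    have hrel := h.rel_associated (s := q ::ₘ s) (t := t)
      (fun x hx => (Multiset.mem_cons.1 hx).elim (fun e => e ▸ hq) (hs x)) ht (by simp [hc])
      (by simpa [← hc] using h0) (by simpa [← hc] using hu)
    exact Multiset.exists_mem_of_rel_of_mem hrel (Multiset.mem_cons_self _ _)

theorem IsUFR.uniqueFactorizationMonoid [IsDomain R] (h : IsUFR R) :
    UniqueFactorizationMonoid R := by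
  refine UniqueFactorizationMonoid.of_exists_prime_factors fun a ha => ?_
  by_cases hu : IsUnit a
  · exact ⟨0, by simp, by simpa using (associated_one_iff_isUnit.2 hu).symm⟩
  obtain ⟨s, hs, rfl⟩ := h.exists_irreducible_factors ha hu
  refine ⟨s, fun q hq => ⟨(hs q hq).ne_zero, (hs q hq).not_isUnit, fun a b hab => ?_⟩, .refl _⟩
  have hq := hs q hq
  rcases eq_or_ne a 0 with rfl | ha0
  · exact Or.inl (dvd_zero q)
  rcases eq_or_ne b 0 with rfl | hb0
  · exact Or.inr (dvd_zero q)
  by_cases hau : IsUnit a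
  · exact Or.inr (hau.dvd_mul_left.1 hab)
  by_cases hbu : IsUnit b
  · exact Or.inl (hbu.dvd_mul_right.1 hab)
  obtain ⟨t, ht, rfl⟩ := h.exists_irreducible_factors ha0 hau
  obtain ⟨t', ht', rfl⟩ := h.exists_irreducible_factors hb0 hbu
  obtain ⟨p, hp, hqp⟩ := h.exists_mem_associated (t := t + t') hq
    (fun x hx => (Multiset.mem_add.1 hx).elim (ht x) (ht' x))
    (by rw [Multiset.prod_add]; exact mul_ne_zero ha0 hb0) (by rwa [Multiset.prod_add])
  exact (Multiset.mem_add.1 hp).imp (fun hp => hqp.dvd.trans (Multiset.dvd_prod hp))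
    fun hp => hqp.dvd.trans (Multiset.dvd_prod hp)

/-- Since `p * (q + x) = p * q`, uniqueness makes `q + x` an associate of `q`. -/
theorem IsUFR.dvd_of_mul_eq_zero (h : IsUFR R) {p q x : R} (hp : Irreducible p)
    (hq : Irreducible q) (hpq : p * q ≠ 0) (hx : p * x = 0) : q ∣ x := by
  have he : p * (q + x) = p * q := by rw [mul_add, hx, add_zero]
  have hu : ¬ IsUnit (p * q) := fun hu => hp.not_isUnit (isUnit_of_mul_isUnit_left hu)
  have hqx : ¬ IsUnit (q + x) := by
    rintro ⟨u, hu⟩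
    refine hq.not_isUnit (isUnit_of_mul_isUnit_left (y := ((u⁻¹ : Rˣ) : R))
      (h.isPresimplifiable p _ (left_ne_zero_of_mul hpq) ?_))
    rw [← mul_assoc, ← he, ← hu, Units.mul_inv_cancel_right]
  obtain ⟨s, hs, hsq⟩ := h.exists_irreducible_factors
    (right_ne_zero_of_mul (he ▸ hpq)) hqx
  have hrel := h.rel_associated (s := {p, q}) (t := p ::ₘ s) (by simp [hp, hq])
    (fun y hy => (Multiset.mem_cons.1 hy).elim (fun e => e ▸ hp) (hs y))
    (by simp [hsq, he]) (by simpa using hpq) (by simpa using hu)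
  have hcard : s.card = 1 := by simpa using (Multiset.card_eq_card_of_rel hrel).symm
  obtain ⟨q', rfl⟩ := Multiset.card_eq_one.1 hcard
  rw [Multiset.prod_singleton] at hsq
  have hqq' : Associated q q' := by
    obtain ⟨y, hy, hqy⟩ := Multiset.exists_mem_of_rel_of_mem hrel (a := q) (by simp)
    obtain ⟨z, hz, hqz⟩ := Multiset.exists_mem_of_rel_of_mem (Multiset.rel_flip.2 hrel)
      (a := q') (by simp)
    simp only [Multiset.mem_cons, Multiset.mem_singleton, Multiset.insert_eq_cons] at hy hz
    rcases hy with rfl | rfl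
    · rcases hz with rfl | rfl
      · exact hqy.trans hqz
      · exact hqz
    · exact hqy
  exact (dvd_add_right dvd_rfl).1 (hsq ▸ hqq'.dvd)

open IsLocalRing

variable [IsLocalRing R] {n : ℕ}

theorem IsUFR.exists_maximalIdeal_eq_span (h : IsUFR R) (hn : IsNilpIndex (maximalIdeal R) n)
    (h2 : maximalIdeal R ^ 2 ≠ ⊥) : ∃ p, maximalIdeal R = Ideal.span {p} := by
  obtain ⟨p, q, hp, hq, hpq⟩ : ∃ p q : R, Irreducible p ∧ Irreducible q ∧ p * q ≠ 0 := by
    obtain ⟨a, ha, b, hb, hab⟩ : ∃ a ∈ maximalIdeal R, ∃ b ∈ maximalIdeal R, a * b ≠ 0 := by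
      by_contra! hcon
      refine h2 (eq_bot_iff.2 ?_)
      rw [pow_two, Ideal.mul_le]
      exact hcon
    obtain ⟨p, hp, c, rfl⟩ := h.exists_irreducible_dvd (left_ne_zero_of_mul hab) ha
    obtain ⟨q, hq, d, rfl⟩ := h.exists_irreducible_dvd (right_ne_zero_of_mul hab) hb
    exact ⟨p, q, hp, hq, fun h0 => hab (by
      rw [show p * c * (q * d) = p * q * (c * d) by ring, h0, zero_mul])⟩
  -- If `p * r = 0` then `q ∣ r`, so `r` is a unit multiple of `q`, against `p * q ≠ 0`.
  have hmul : ∀ r, Irreducible r → p * r ≠ 0 := by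
    intro r hr h0
    obtain ⟨c, rfl⟩ := h.dvd_of_mul_eq_zero hp hq hpq h0
    have hc := (hr.isUnit_or_isUnit rfl).resolve_left hq.not_isUnit
    rw [← mul_assoc, hc.mul_left_eq_zero] at h0
    exact hpq h0
  -- With `p ^ k` the last nonzero power, `p * p ^ k = 0` gives `r ∣ p ^ k`, and uniqueness makes
  -- `r` an associate of `p`.
  have hdvd : ∀ r, Irreducible r → p ∣ r := by
    intro r hr
    classical
    have hnil : ∃ k, p ^ k = 0 := isNilpotent_of_mem_maximalIdeal hn hp.not_isUnit
    obtain ⟨k, hk⟩ := Nat.exists_eq_succ_of_ne_zero (n := Nat.find hnil) fun h0 => by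
      have := Nat.find_spec hnil
      rw [h0, pow_zero] at this
      exact one_ne_zero this
    have hk0 : p ^ k ≠ 0 := Nat.find_min hnil (by omega)
    have hk1 : p * p ^ k = 0 := by
      have := Nat.find_spec hnil
      rwa [hk, pow_succ'] at this
    obtain ⟨x, hx, hrx⟩ := h.exists_mem_associated (t := Multiset.replicate k p) hr
      (fun x hx => Multiset.eq_of_mem_replicate hx ▸ hp) (by simpa using hk0)
      (by simpa using h.dvd_of_mul_eq_zero hp hr (hmul r hr) hk1)
    rw [Multiset.eq_of_mem_replicate hx] at hrx
    exact hrx.symm.dvd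
  refine ⟨p, le_antisymm (fun x hx => ?_) ?_⟩
  · rw [Ideal.mem_span_singleton]
    rcases eq_or_ne x 0 with rfl | hx0
    · exact dvd_zero p
    · obtain ⟨r, hr, hrx⟩ := h.exists_irreducible_dvd hx0 hx
      exact (hdvd r hr).trans hrx
  · exact (Ideal.span_singleton_le_iff_mem _).2 hp.not_isUnit

theorem exists_unit_mul_pow {p : R} (hp : maximalIdeal R = Ideal.span {p}) {i : ℕ} {x : R}
    (hx : x ∈ maximalIdeal R ^ i) (hx' : x ∉ maximalIdeal R ^ (i + 1)) :
    ∃ u, IsUnit u ∧ x = p ^ i * u := by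
  have hx0 := hx
  rw [hp, Ideal.span_singleton_pow, Ideal.mem_span_singleton] at hx0
  obtain ⟨u, rfl⟩ := hx0
  refine ⟨u, notMem_maximalIdeal.1 fun hu => hx' ?_, rfl⟩
  rw [pow_succ]
  exact Ideal.mul_mem_mul (Ideal.pow_mem_pow (hp ▸ Ideal.mem_span_singleton_self p) i) hu

theorem condA'_of_eq_span (hn : IsNilpIndex (maximalIdeal R) n) {p : R}
    (hp : maximalIdeal R = Ideal.span {p}) : CondA' (maximalIdeal R) n := by
  intro i j hij x y hx hx' hy hy'
  refine ⟨by rw [pow_add]; exact Ideal.mul_mem_mul hx hy, fun hcon => ?_⟩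
  obtain ⟨u, hu, rfl⟩ := exists_unit_mul_pow hp hx hx'
  obtain ⟨v, hv, rfl⟩ := exists_unit_mul_pow hp hy hy'
  rw [show p ^ i * u * (p ^ j * v) = u * v * p ^ (i + j) by ring,
    Ideal.unit_mul_mem_iff_mem _ (hu.mul hv)] at hcon
  -- Powers of `M` stabilizing before exponent `n` would force `M ^ (n - 1) = 0`.
  have hle : maximalIdeal R ^ (i + j) ≤ maximalIdeal R ^ (i + j + 1) := by
    nth_rewrite 1 [hp]
    rwa [Ideal.span_singleton_pow, Ideal.span_singleton_le_iff_mem]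
  apply hn.2.2
  rw [eq_bot_iff, ← hn.2.1]
  calc maximalIdeal R ^ (n - 1)
      = maximalIdeal R ^ (i + j) * maximalIdeal R ^ (n - 1 - (i + j)) := by
        rw [← pow_add]; congr 1; omega
    _ ≤ maximalIdeal R ^ (i + j + 1) * maximalIdeal R ^ (n - 1 - (i + j)) :=
        Ideal.mul_mono_left hle
    _ = maximalIdeal R ^ n := by rw [← pow_add]; congr 1; omega

theorem condB_of_eq_span {p : R} (hp : maximalIdeal R = Ideal.span {p}) :
    CondB (maximalIdeal R) := by
  intro a ha ha2
  obtain ⟨u, hu, rfl⟩ := exists_unit_mul_pow (i := 1) hp (by simpa using ha) ha2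
  rw [Ideal.span_singleton_mul_right_unit hu, pow_one, ← hp, pow_two]

theorem condA_of_sq_eq_bot (hn : IsNilpIndex (maximalIdeal R) n)
    (h2 : maximalIdeal R ^ 2 = ⊥) : CondA (maximalIdeal R) n := by
  intro k hk hkn x hx
  have hn2 : n ≤ 2 := by
    by_contra hcon
    apply hn.2.2
    rw [eq_bot_iff, ← h2]
    exact Ideal.pow_le_pow_right (by omega)
  obtain rfl : k = 1 := by omega
  simpa using hx 0

theorem condB_of_sq_eq_bot (h2 : maximalIdeal R ^ 2 = ⊥) : CondB (maximalIdeal R) := by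
  intro a ha _
  rw [h2, eq_bot_iff, ← h2, pow_two]
  exact Ideal.mul_mono_left ((Ideal.span_singleton_le_iff_mem _).2 ha)

theorem IsUFR.isFFR_polynomial_of_isLocalRing [Finite R] (h : IsUFR R) : IsFFR R[X] := by
  obtain ⟨n, hn⟩ := exists_isNilpIndex (R := R)
  by_cases h2 : maximalIdeal R ^ 2 = ⊥
  · exact FactorRing.isFFR_polynomial_of_isLocalRing hn (condA_of_sq_eq_bot hn h2)
      (condB_of_sq_eq_bot h2)
  · obtain ⟨p, hp⟩ := h.exists_maximalIdeal_eq_span hn h2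
    exact FactorRing.isFFR_polynomial_of_isLocalRing hn (condA'_of_eq_span hn hp).condA
      (condB_of_eq_span hp)

end UFR

/-! ### The dichotomy between domains and finite rings, and the conclusion. -/

section Main

variable {R : Type*} [CommRing R] [Nontrivial R]

theorem IsUFR.isFFR_polynomial_of_finite [Finite R] (h : IsUFR R) : IsFFR R[X] :=
  have := h.isPresimplifiable.isLocalRing
  h.isFFR_polynomial_of_isLocalRing

theorem isDomain_or_finite_of_isFFR (h : IsFFR R[X]) : IsDomain R ∨ Finite R := by
  by_cases hz : ∃ z w : R, z ≠ 0 ∧ w ≠ 0 ∧ z * w = 0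
  · obtain ⟨z, w, hz, hw, hzw⟩ := hz
    exact Or.inr (finite_of_mul_eq_zero h hz hw hzw)
  · push Not at hz
    have : NoZeroDivisors R := ⟨fun {a b} hab => by
      by_contra! hcon
      exact hz a b hcon.1 hcon.2 hab⟩
    exact Or.inl (NoZeroDivisors.to_isDomain R)

end Main

end FactorRing

theorem theorem6p3 {R : Type*} [CommRing R] [Nontrivial R] :
    (FactorRing.IsFFR R[X] ↔
      FactorRing.IsFFD R ∨
        (Finite R ∧ ∃ _ : IsLocalRing R, ∃ n : ℕ,
          FactorRing.IsNilpIndex (IsLocalRing.maximalIdeal R) n ∧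
          FactorRing.CondA (IsLocalRing.maximalIdeal R) n ∧
          FactorRing.CondB (IsLocalRing.maximalIdeal R))) ∧
    (Finite R → ∀ _ : IsLocalRing R, ∀ n : ℕ,
      FactorRing.IsNilpIndex (IsLocalRing.maximalIdeal R) n →
      FactorRing.CondB (IsLocalRing.maximalIdeal R) →
        (FactorRing.CondA (IsLocalRing.maximalIdeal R) n ↔
          FactorRing.CondA' (IsLocalRing.maximalIdeal R) n)) ∧
    (FactorRing.IsUFR R →
      (FactorRing.IsFFR R[X] ↔ (IsDomain R ∧ UniqueFactorizationMonoid R) ∨ Finite R)) := by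
  refine ⟨⟨fun h => ?_, ?_⟩, ?_, fun hufr => ⟨fun h => ?_, ?_⟩⟩
  · rcases FactorRing.isDomain_or_finite_of_isFFR h with hd | hf
    · exact Or.inl ⟨hd, FactorRing.isFFR_of_isFFR_polynomial h⟩
    · have hl := h.isPresimplifiable.of_polynomial.isLocalRing
      obtain ⟨n, hn⟩ := FactorRing.exists_isNilpIndex (R := R)
      exact Or.inr ⟨hf, hl, n, hn, FactorRing.condA_of_isFFR h hn, FactorRing.condB_of_isFFR h hn⟩
  · rintro (⟨hd, h⟩ | ⟨hf, hl, n, hn, hA, hB⟩)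
    · exact FactorRing.isFFR_polynomial_of_isDomain h
    · exact FactorRing.isFFR_polynomial_of_isLocalRing hn hA hB
  · exact fun _ _ n hn hB => ⟨fun hA => hA.condA' hn hB, fun hA => hA.condA⟩
  · rcases FactorRing.isDomain_or_finite_of_isFFR h with hd | hf
    · exact Or.inl ⟨hd, hufr.uniqueFactorizationMonoid⟩
    · exact Or.inr hf
  · rintro (⟨hd, hufm⟩ | hf)
    · exact FactorRing.isFFR_polynomial_of_isDomain
        (FactorRing.isFFR_of_finite_divisors fun a ha => FactorRing.finite_divisors_of_ufm ha)
    · exact hufr.isFFR_polynomial_of_finite
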